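/- A bounded lattice is an algebra $(L,\wedge,\vee,0,1)$ whose reduct $(L,\wedge,\vee)$ is a lattice with bottom element $0$ and top element $1$ (the case $0=1$ is allowed). A quasi-identity is a sentence $q=(\forall\bar x)\,[\varphi(\bar x)\to\psi(\bar x)]$, where $\varphi$ is a finite, possibly empty, conjunction of equations between terms in the language $\{\wedge,\vee,0,1\}$ and $\psi$ is one such equation; it is an identity if $\varphi$ is empty. A variety of bounded lattices is the class of all bounded lattices that satisfy some given set of identities. Let $\mathcal V$ be a variety of bounded lattices, and let $\mathbf F$ be the free algebra for $\mathcal V$ over a countably infinite set of generators, i.e. the algebra of terms in the variables $v_0,v_1,v_2,\dots$ modulo the congruence that identifies two terms when they determine the same term operation on every member of $\mathcal V$. For a quasi-identity $q$ as above put $q^*=(\forall\bar x)\,[\neg\varphi(\bar x)]$, and call $q$ $\mathcal V$-active if $q$ is true in $\mathbf F$ and $q^*$ is not true in $\mathbf F$. The variety $\mathcal V$ is structurally complete (SC) if every quasi-identity true in $\mathbf F$ is true in all members of $\mathcal V$; it is almost structurally complete (ASC) if every $\mathcal V$-active quasi-identity is true in all members of $\mathcal V$. **Proposition.** For every variety $\mathcal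 V$ of bounded lattices the following conditions are equivalent: 1. $\mathcal V$ is SC; 2. $\mathcal V$ is ASC; 3. $\mathcal V$ satisfies the distributivity law $(\forall x,y,z)\,[x\wedge(y\vee z)\approx(x\wedge y)\vee(x\wedge z)]$. -/

import Mathlib

universe u

namespace BoundedLatticeVariety

/-- Terms in the language of bounded lattices over the variables `v₀, v₁, v₂, …`. -/
inductive BTerm : Type
  | var (n : ℕ) : BTerm
  | bot : BTerm
  | top : BTerm
  | inf (s t : BTerm) : BTerm
  | sup (s t : BTerm) : BTerm

/-- The value of a term in a bounded lattice `L` under an assignment of its variables. -/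
def BTerm.eval {L : Type*} [Lattice L] [BoundedOrder L] (a : ℕ → L) : BTerm → L
  | .var n => a n
  | .bot => ⊥
  | .top => ⊤
  | .inf s t => s.eval a ⊓ t.eval a
  | .sup s t => s.eval a ⊔ t.eval a

/-- An equation `lhs ≈ rhs` between terms. -/
structure Equation : Type where
  lhs : BTerm
  rhs : BTerm

/-- The equation `e` holds in `L` under the assignment `a`. -/
def Equation.HoldsAt {L : Type*} [Lattice L] [BoundedOrder L] (e : Equation) (a : ℕ → L) : Prop :=
  e.lhs.eval a = e.rhs.eval a

/-- The identity `(∀ x̄) e` is true in `L`. -/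
def Equation.TrueIn (e : Equation) (L : Type*) [Lattice L] [BoundedOrder L] : Prop :=
  ∀ a : ℕ → L, e.HoldsAt a

/-- A quasi-identity `(∀ x̄) [s₁ ≈ t₁ ∧ ⋯ ∧ sₙ ≈ tₙ → s ≈ t]`, where `n = 0` is allowed. -/
structure QuasiIdentity : Type where
  premise : List Equation
  conclusion : Equation

/-- All equations of the premise of `q` hold in `L` under the assignment `a`. -/
def QuasiIdentity.PremiseAt {L : Type*} [Lattice L] [BoundedOrder L]
    (q : QuasiIdentity) (a : ℕ → L) : Prop :=
  ∀ e ∈ q.premise, e.HoldsAt a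

/-- The quasi-identity `q` is true in `L`. -/
def QuasiIdentity.TrueIn (q : QuasiIdentity) (L : Type*) [Lattice L] [BoundedOrder L] : Prop :=
  ∀ a : ℕ → L, q.PremiseAt a → q.conclusion.HoldsAt a

/-- The sentence `q* = (∀ x̄) ¬φ(x̄)`, with `φ` the premise of `q`, is true in `L`. -/
def QuasiIdentity.StarTrueIn (q : QuasiIdentity) (L : Type*) [Lattice L] [BoundedOrder L] : Prop :=
  ∀ a : ℕ → L, ¬ q.PremiseAt a

/-- A variety of bounded lattices: the class of all bounded lattices in which
all identities of some set are true. -/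
def IsVariety (V : Set BddLat.{u}) : Prop :=
  ∃ E : Set Equation, ∀ L : BddLat.{u}, L ∈ V ↔ ∀ e ∈ E, e.TrueIn L

/-- Terms are identified when they determine the same term operation on every member of `V`. -/
def termSetoid (V : Set BddLat.{u}) : Setoid BTerm where
  r s t := ∀ L ∈ V, ∀ a : ℕ → L, s.eval a = t.eval a
  iseqv :=
    { refl := fun _ _ _ _ => rfl
      symm := fun h L hL a => (h L hL a).symm
      trans := fun h k L hL a => (h L hL a).trans (k L hL a) }

/-- The free algebra `F` for `V` over the countably infinite set of variables `v₀, v₁, v₂, …`: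
the algebra of terms modulo the identities true in `V`. -/
def FreeAlgebra (V : Set BddLat.{u}) : Type :=
  Quotient (termSetoid V)

/-- The element of `F` represented by a term. -/
def FreeAlgebra.mk (V : Set BddLat.{u}) (t : BTerm) : FreeAlgebra V :=
  Quotient.mk (termSetoid V) t

namespace FreeAlgebra

variable (V : Set BddLat.{u})

instance : Max (FreeAlgebra V) :=
  ⟨Quotient.map₂ BTerm.sup fun _ _ h _ _ k L hL a => congrArg₂ (· ⊔ ·) (h L hL a) (k L hL a)⟩

instance : Min (FreeAlgebra V) :=
  ⟨Quotient.map₂ BTerm.inf fun _ _ h _ _ k L hL a => congrArg₂ (· ⊓ ·) (h L hL a) (k L hL a)⟩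

/-- The operations on `F` are those induced by the term constructors; the order is the one
they determine (`p ≤ q` iff `p ⊔ q = q`). -/
instance : Lattice (FreeAlgebra V) :=
  Lattice.mk'
    (by
      rintro ⟨s⟩ ⟨t⟩
      exact Quotient.sound fun L _ a => sup_comm (s.eval a) (t.eval a))
    (by
      rintro ⟨s⟩ ⟨t⟩ ⟨r⟩
      exact Quotient.sound fun L _ a => sup_assoc (s.eval a) (t.eval a) (r.eval a))
    (by
      rintro ⟨s⟩ ⟨t⟩
      exact Quotient.sound fun L _ a => inf_comm (s.eval a) (t.eval a))
    (by
      rintro ⟨s⟩ ⟨t⟩ ⟨r⟩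
      exact Quotient.sound fun L _ a => inf_assoc (s.eval a) (t.eval a) (r.eval a))
    (by
      rintro ⟨s⟩ ⟨t⟩
      exact Quotient.sound fun L _ a => sup_inf_self (a := s.eval a) (b := t.eval a))
    (by
      rintro ⟨s⟩ ⟨t⟩
      exact Quotient.sound fun L _ a => inf_sup_self (a := s.eval a) (b := t.eval a))

instance : BoundedOrder (FreeAlgebra V) where
  top := mk V BTerm.top
  bot := mk V BTerm.bot
  le_top := by
    rintro ⟨s⟩
    refine sup_eq_right.mp ?_
    exact Quotient.sound fun L _ a => sup_top_eq (s.eval a)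
  bot_le := by
    rintro ⟨s⟩
    refine sup_eq_right.mp ?_
    exact Quotient.sound fun L _ a => bot_sup_eq (s.eval a)

end FreeAlgebra

/-- `q` is `V`-active: it is true in the free algebra `F`, and `q*` is not. -/
def IsActive (V : Set BddLat.{u}) (q : QuasiIdentity) : Prop :=
  q.TrueIn (FreeAlgebra V) ∧ ¬ q.StarTrueIn (FreeAlgebra V)

/-- `V` is structurally complete: every quasi-identity true in `F` is true in `V`. -/
def IsSC (V : Set BddLat.{u}) : Prop :=
  ∀ q : QuasiIdentity, q.TrueIn (FreeAlgebra V) → ∀ L ∈ V, q.TrueIn L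

/-- `V` is almost structurally complete: every `V`-active quasi-identity is true in `V`. -/
def IsASC (V : Set BddLat.{u}) : Prop :=
  ∀ q : QuasiIdentity, IsActive V q → ∀ L ∈ V, q.TrueIn L

/-- The identity `x ⊓ (y ⊔ z) ≈ (x ⊓ y) ⊔ (x ⊓ z)`. -/
def distributiveLaw : Equation where
  lhs := .inf (.var 0) (.sup (.var 1) (.var 2))
  rhs := .sup (.inf (.var 0) (.var 1)) (.inf (.var 0) (.var 2))

end BoundedLatticeVariety

/-! ### Cancellation implies distributivity. -/

section LatticeTheory

/-! ASC gives distributivity through one quasi-identity, `uniqueCompl`. In `F` a meet is `⊥` only if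
a factor is, so only `⊥` and `⊤` can have complements; hence `uniqueCompl` is active for every
variety. Under ASC complements are then unique in all members. Intervals of members are again
members, so relative complements are unique too, which forces distributivity.

Conversely, bounded homomorphisms from a distributive lattice to the two-element lattice separate
points, and that lattice embeds in `F` unless `F` is trivial. Quasi-identities thus pass from `F` to
every nontrivial member. -/

/-- Cancellation: an element has at most one relative complement in each interval. -/
def UniqueRelCompl (L : Type*) [Lattice L] : Prop :=
  ∀ x y z : L, x ⊓ y = x ⊓ z → x ⊔ y = x ⊔ z → y = z

variable {L : Type*} [Lattice L]

/-- For `x ≤ z`, the two sides of the modular law have the same meet and the same join with `y`: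
they are the comparable pair of a pentagon. -/
theorem UniqueRelCompl.isModularLattice (h : UniqueRelCompl L) : IsModularLattice L where
  sup_inf_le_assoc_of_le {x} y {z} hxz := by
    have hle : x ⊔ y ⊓ z ≤ (x ⊔ y) ⊓ z :=
      sup_le (le_inf le_sup_left hxz) (inf_le_inf_right z le_sup_right)
    refine (h y _ _ ?_ ?_).ge
    · refine le_antisymm (inf_le_inf_left y hle) (le_inf inf_le_left ?_)
      exact le_sup_of_le_right (inf_le_inf_left y inf_le_right)
    · refine le_antisymm (sup_le_sup_left hle y) (sup_le le_sup_left ?_)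
      exact inf_le_left.trans (sup_le (le_sup_of_le_right le_sup_left) le_sup_left)

/-- The element of the diamond generated by `x, y, z` in a modular lattice that corresponds
to `x`. -/
def diamond (x y z : L) : L := (x ⊔ y ⊓ z) ⊓ (y ⊔ z)

variable [IsModularLattice L]

theorem diamond_eq_sup (x y z : L) : diamond x y z = x ⊓ (y ⊔ z) ⊔ y ⊓ z := by
  rw [diamond, sup_comm x, sup_comm (x ⊓ _)]
  exact sup_inf_assoc_of_le x (inf_le_left.trans le_sup_left)

/-- The right-hand side is symmetric in `x, y, z`, so all pairs among the three diamond elements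
have the same meet; dually for joins below. -/
theorem diamond_inf_diamond (x y z : L) :
    diamond x y z ⊓ diamond y x z = x ⊓ y ⊔ y ⊓ z ⊔ x ⊓ z := by
  have h₁ : diamond x y z ⊓ diamond y x z = (x ⊓ z ⊔ y) ⊓ (x ⊔ y ⊓ z) := by
    unfold diamond
    apply le_antisymm
    · exact le_inf (inf_le_right.trans (inf_le_left.trans (sup_comm _ _).le))
        (inf_le_left.trans inf_le_left)
    · refine le_inf (le_inf inf_le_right (inf_le_left.trans ?_))
        (le_inf (inf_le_left.trans (sup_comm _ _).le) (inf_le_right.trans ?_))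
      · exact sup_le (le_sup_of_le_right inf_le_right) le_sup_left
      · exact sup_le le_sup_left (le_sup_of_le_right inf_le_right)
  have h₂ : y ⊓ (x ⊔ y ⊓ z) = x ⊓ y ⊔ y ⊓ z := by
    rw [inf_comm, sup_comm, sup_inf_assoc_of_le x inf_le_left, sup_comm]
  rw [h₁, sup_inf_assoc_of_le y (le_sup_of_le_left inf_le_left), h₂, sup_comm]

theorem diamond_sup_diamond (x y z : L) :
    diamond x y z ⊔ diamond y x z = (x ⊔ y) ⊓ (y ⊔ z) ⊓ (x ⊔ z) := by
  have h₁ : diamond x y z ⊔ diamond y x z = x ⊓ (y ⊔ z) ⊔ y ⊓ (x ⊔ z) := by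
    rw [diamond_eq_sup, diamond_eq_sup]
    apply le_antisymm
    · refine sup_le (sup_le le_sup_left (le_sup_of_le_right ?_))
        (sup_le le_sup_right (le_sup_of_le_left ?_))
      · exact inf_le_inf_left y le_sup_right
      · exact inf_le_inf_left x le_sup_right
    · exact sup_le_sup le_sup_left le_sup_left
  have h₂ : x ⊓ (y ⊔ z) ⊔ y = (x ⊔ y) ⊓ (y ⊔ z) := by
    rw [sup_comm, ← sup_inf_assoc_of_le x le_sup_left, sup_comm y x]
  rw [h₁, ← sup_inf_assoc_of_le y (inf_le_left.trans le_sup_left), h₂]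

omit [IsModularLattice L] in
theorem UniqueRelCompl.inf_sup_left (h : UniqueRelCompl L) (x y z : L) :
    x ⊓ (y ⊔ z) = x ⊓ y ⊔ x ⊓ z := by
  have := h.isModularLattice
  have comm (a b c : L) : diamond a b c = diamond a c b := by
    rw [diamond, diamond, inf_comm b, sup_comm b]
  set d := x ⊓ y ⊔ y ⊓ z ⊔ x ⊓ z with hd
  set e := (x ⊔ y) ⊓ (y ⊔ z) ⊓ (x ⊔ z) with he
  have hxy : diamond x y z ⊓ diamond y x z = d := diamond_inf_diamond x y z
  have hxy' : diamond x y z ⊔ diamond y x z = e := diamond_sup_diamond x y z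
  have hxz : diamond x y z ⊓ diamond z x y = d := by
    rw [comm x, diamond_inf_diamond, hd, inf_comm z y, sup_right_comm, sup_assoc, sup_comm]
  have hxz' : diamond x y z ⊔ diamond z x y = e := by
    rw [comm x, diamond_sup_diamond, he, sup_comm z y]
    ac_rfl
  have hyz : diamond y x z ⊓ diamond z x y = d := by
    rw [comm y, comm z, diamond_inf_diamond, hd, inf_comm z x, inf_comm y x]
    ac_rfl
  have hyz' : diamond y x z ⊔ diamond z x y = e := by
    rw [comm y, comm z, diamond_sup_diamond, he, sup_comm z x, sup_comm y x]
    ac_rfl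
  -- Two atoms of the diamond are relative complements of the third, so they coincide and the
  -- diamond collapses.
  have heq := h _ _ _ (hxy.trans hxz.symm) (hxy'.trans hxz'.symm)
  have hde : d = e := by rw [← hyz, ← hyz', heq, inf_idem, sup_idem]
  refine le_antisymm ?_ le_inf_sup
  -- Meeting `d = e` with `x` and applying the modular law to `d` yields distributivity.
  have h₁ : x ⊓ (y ⊔ z) ≤ d ⊓ x := by
    rw [hde]
    exact le_inf (le_inf (le_inf (inf_le_left.trans le_sup_left) inf_le_right)
      (inf_le_left.trans le_sup_left)) inf_le_left
  have h₂ : d = (x ⊓ y ⊔ x ⊓ z) ⊔ y ⊓ z := by rw [hd, sup_right_comm]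
  rw [h₂, sup_inf_assoc_of_le (y ⊓ z) (sup_le inf_le_left inf_le_left)] at h₁
  refine h₁.trans (sup_le le_rfl (le_sup_of_le_left ?_))
  exact le_inf inf_le_right (inf_le_left.trans inf_le_left)

end LatticeTheory

namespace BoundedLatticeVariety

/-! ### Terms and identities in intervals. -/

section Terms

variable {L : Type*} [Lattice L] [BoundedOrder L]

theorem BTerm.eval_map {M : Type*} [Lattice M] [BoundedOrder M]
    (f : BoundedLatticeHom L M) (a : ℕ → L) (t : BTerm) :
    t.eval (fun n => f (a n)) = f (t.eval a) := by
  induction t with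
  | var n => rfl
  | bot => exact (map_bot f).symm
  | top => exact (map_top f).symm
  | inf s t hs ht => exact (congrArg₂ _ hs ht).trans (map_inf f _ _).symm
  | sup s t hs ht => exact (congrArg₂ _ hs ht).trans (map_sup f _ _).symm

/-- Under an assignment in an interval `[p, q]`, a term takes the same value in `L` and in
`[p, q]`, unless its value is an endpoint of both. -/
theorem BTerm.eval_Icc {p q : L} [Fact (p ≤ q)] (a : ℕ → Set.Icc p q) (t : BTerm) :
    (t.eval (fun n => (a n : L)) = ((t.eval a : Set.Icc p q) : L)) ∨
      (t.eval (fun n => (a n : L)) = ⊥ ∧ t.eval a = ⊥) ∨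
      (t.eval (fun n => (a n : L)) = ⊤ ∧ t.eval a = ⊤) := by
  induction t with
  | var n => exact .inl rfl
  | bot => exact .inr (.inl ⟨rfl, rfl⟩)
  | top => exact .inr (.inr ⟨rfl, rfl⟩)
  | inf s t hs ht =>
    simp only [BTerm.eval]
    rcases hs with hs | ⟨hs, hs'⟩ | ⟨hs, hs'⟩ <;> rcases ht with ht | ⟨ht, ht'⟩ | ⟨ht, ht'⟩ <;>
      simp [*]
  | sup s t hs ht =>
    simp only [BTerm.eval]
    rcases hs with hs | ⟨hs, hs'⟩ | ⟨hs, hs'⟩ <;> rcases ht with ht | ⟨ht, ht'⟩ | ⟨ht, ht'⟩ <;>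
      simp [*]

/-- An interval has its own bounds, so it is usually not a subalgebra. Still, its term values are
those of `L` clamped to `[p, q]`, hence identities descend. -/
theorem BTerm.coe_eval_Icc {p q : L} [Fact (p ≤ q)] (a : ℕ → Set.Icc p q) (t : BTerm) :
    ((t.eval a : Set.Icc p q) : L) = (t.eval (fun n => (a n : L)) ⊔ p) ⊓ q := by
  have hpq : p ≤ q := Fact.out
  rcases t.eval_Icc a with h | ⟨h, h'⟩ | ⟨h, h'⟩
  · rw [h, sup_eq_left.2 (t.eval a).2.1, inf_eq_left.2 (t.eval a).2.2]
  · rw [h, h', bot_sup_eq, inf_eq_left.2 hpq]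
    rfl
  · rw [h, h', top_sup_eq, top_inf_eq]
    rfl

theorem Equation.TrueIn.Icc {e : Equation} (he : e.TrueIn L) (p q : L) [Fact (p ≤ q)] :
    e.TrueIn (Set.Icc p q) := fun a => by
  apply Subtype.ext
  rw [BTerm.coe_eval_Icc, BTerm.coe_eval_Icc, he (fun n => (a n : L))]

end Terms

/-- A term is either identically `⊥`, or takes the value `⊤` when all variables are `⊤`. -/
theorem BTerm.eval_eq_bot_or_eval_top (t : BTerm) :
    (∀ (L : BddLat.{u}) (a : ℕ → L), t.eval a = ⊥) ∨
      ∀ L : BddLat.{u}, t.eval (fun _ => (⊤ : L)) = ⊤ := by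
  induction t with
  | var n => exact .inr fun L => rfl
  | bot => exact .inl fun L a => rfl
  | top => exact .inr fun L => rfl
  | inf s t hs ht =>
    rcases hs with hs | hs
    · exact .inl fun L a => by rw [BTerm.eval, hs, bot_inf_eq]
    rcases ht with ht | ht
    · exact .inl fun L a => by rw [BTerm.eval, ht, inf_bot_eq]
    · exact .inr fun L => by rw [BTerm.eval, hs, ht, inf_idem]
  | sup s t hs ht =>
    rcases hs with hs | hs
    · rcases ht with ht | ht
      · exact .inl fun L a => by rw [BTerm.eval, hs, ht, sup_idem]
      · exact .inr fun L => by rw [BTerm.eval, ht, sup_top_eq]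
    · exact .inr fun L => by rw [BTerm.eval, hs, top_sup_eq]

theorem FreeAlgebra.eq_bot_or_eq_bot {V : Set BddLat.{u}} {x y : FreeAlgebra V}
    (h : x ⊓ y = ⊥) : x = ⊥ ∨ y = ⊥ := by
  induction x using Quotient.inductionOn with | _ s
  induction y using Quotient.inductionOn with | _ t
  have h' : ∀ L ∈ V, ∀ a : ℕ → L, s.eval a ⊓ t.eval a = ⊥ := Quotient.exact h
  rcases s.eval_eq_bot_or_eval_top with hs | hs
  · exact .inl (Quotient.sound fun L _ a => hs L a)
  rcases t.eval_eq_bot_or_eval_top with ht | ht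
  · exact .inr (Quotient.sound fun L _ a => ht L a)
  -- Neither term is identically `⊥`, so evaluating at `⊤` makes every member of `V` trivial.
  · refine .inl (Quotient.sound fun L hL a => ?_)
    have hL' := h' L hL fun _ => ⊤
    rw [hs, ht, inf_idem] at hL'
    exact eq_bot_mono le_top hL'

/-- The quasi-identity stating that complements are unique. -/
def uniqueCompl : QuasiIdentity where
  premise :=
    [⟨.inf (.var 0) (.var 1), .bot⟩, ⟨.inf (.var 0) (.var 2), .bot⟩,
      ⟨.sup (.var 0) (.var 1), .top⟩, ⟨.sup (.var 0) (.var 2), .top⟩]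
  conclusion := ⟨.var 1, .var 2⟩

theorem uniqueCompl_premiseAt {L : Type*} [Lattice L] [BoundedOrder L] {a : ℕ → L} :
    uniqueCompl.PremiseAt a ↔
      a 0 ⊓ a 1 = ⊥ ∧ a 0 ⊓ a 2 = ⊥ ∧ a 0 ⊔ a 1 = ⊤ ∧ a 0 ⊔ a 2 = ⊤ := by
  simp [QuasiIdentity.PremiseAt, uniqueCompl, Equation.HoldsAt, BTerm.eval]

theorem isActive_uniqueCompl (V : Set BddLat.{u}) : IsActive V uniqueCompl := by
  constructor
  · intro a ha
    obtain ⟨h₁, h₂, h₃, h₄⟩ := uniqueCompl_premiseAt.1 ha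
    change a 1 = a 2
    by_cases h₀ : a 0 = ⊥
    · rw [h₀, bot_sup_eq] at h₃ h₄
      rw [h₃, h₄]
    · rw [(FreeAlgebra.eq_bot_or_eq_bot h₁).resolve_left h₀,
        (FreeAlgebra.eq_bot_or_eq_bot h₂).resolve_left h₀]
  · intro h
    -- The pair `⊥, ⊤` satisfies the premise in any bounded lattice.
    refine h (fun n => if n = 0 then ⊥ else ⊤) (uniqueCompl_premiseAt.2 ?_)
    simp

theorem IsASC.uniqueRelCompl {V : Set BddLat.{u}} (hV : IsVariety V) (h : IsASC V)
    {L : BddLat.{u}} (hL : L ∈ V) : UniqueRelCompl L := by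
  intro x y z hinf hsup
  obtain ⟨E, hE⟩ := hV
  have : Fact (x ⊓ y ≤ x ⊔ y) := ⟨inf_le_left.trans le_sup_left⟩
  have hI : BddLat.of (Set.Icc (x ⊓ y) (x ⊔ y)) ∈ V :=
    (hE _).2 fun e he => ((hE L).1 hL e he).Icc _ _
  let x' : Set.Icc (x ⊓ y) (x ⊔ y) := ⟨x, inf_le_left, le_sup_left⟩
  let y' : Set.Icc (x ⊓ y) (x ⊔ y) := ⟨y, inf_le_right, le_sup_right⟩
  let z' : Set.Icc (x ⊓ y) (x ⊔ y) := ⟨z, hinf.trans_le inf_le_right, le_sup_right.trans hsup.ge⟩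
  have key : y' = z' := h uniqueCompl (isActive_uniqueCompl V) _ hI
    (fun n => if n = 0 then x' else if n = 1 then y' else z')
    (uniqueCompl_premiseAt.2 ⟨rfl, Subtype.ext hinf.symm, rfl, Subtype.ext hsup.symm⟩)
  exact congrArg Subtype.val key

theorem distributiveLaw_trueIn_iff {L : Type*} [Lattice L] [BoundedOrder L] :
    distributiveLaw.TrueIn L ↔ ∀ x y z : L, x ⊓ (y ⊔ z) = x ⊓ y ⊔ x ⊓ z :=
  ⟨fun h x y z => h fun n => if n = 0 then x else if n = 1 then y else z,
    fun h a => h (a 0) (a 1) (a 2)⟩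

/-! ### Distributive lattices and the two-element lattice. -/

/-- In a bounded distributive lattice, homomorphisms to the two-element lattice separate
points. -/
theorem exists_boundedLatticeHom_prop {L : Type*} [DistribLattice L] [BoundedOrder L] {x y : L}
    (h : ¬ x ≤ y) : ∃ f : BoundedLatticeHom L Prop, f x ∧ ¬ f y := by
  obtain ⟨J, hJ, hyJ, hxJ⟩ := DistribLattice.prime_ideal_of_disjoint_filter_ideal
    (F := Order.PFilter.principal x) (I := Order.Ideal.principal y)
    (Set.disjoint_left.2 fun z hz hz' => h (le_trans hz hz'))
  have hxJ' : x ∉ J := Set.disjoint_left.1 hxJ (show x ≤ x from le_rfl)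
  refine ⟨⟨⟨⟨fun z => z ∉ J, fun a b => ?_⟩, fun a b => ?_⟩, ?_, ?_⟩, hxJ', ?_⟩
  · simp only [Order.Ideal.sup_mem_iff, not_and_or]
    rfl
  · have : a ⊓ b ∈ J ↔ a ∈ J ∨ b ∈ J :=
      ⟨hJ.mem_or_mem, fun hab => hab.elim (J.lower inf_le_left) (J.lower inf_le_right)⟩
    simp only [this, not_or]
    rfl
  · exact eq_top_iff.2 fun _ hT => hxJ' (J.lower le_top hT)
  · exact eq_bot_iff.2 fun hB => hB J.bot_mem
  · exact not_not.2 (hyJ (show y ≤ y from le_rfl))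

open Classical in
/-- The unique homomorphism from the two-element lattice to a bounded lattice. -/
noncomputable def propHom (M : Type*) [Lattice M] [BoundedOrder M] :
    BoundedLatticeHom Prop M where
  toFun p := if p then ⊤ else ⊥
  map_sup' p q := by by_cases hp : p <;> by_cases hq : q <;> simp [hp, hq]
  map_inf' p q := by by_cases hp : p <;> by_cases hq : q <;> simp [hp, hq]
  map_top' := by simp
  map_bot' := by simp

/-- A quasi-identity true in a nontrivial bounded lattice is true in all distributive ones. -/
theorem QuasiIdentity.TrueIn.of_distribLattice {M : Type*} [Lattice M] [BoundedOrder M]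
    (hM : (⊥ : M) ≠ ⊤) {q : QuasiIdentity} (hq : q.TrueIn M)
    {L : Type*} [DistribLattice L] [BoundedOrder L] : q.TrueIn L := by
  intro a ha
  have key (f : BoundedLatticeHom L Prop) :
      f (q.conclusion.lhs.eval a) = f (q.conclusion.rhs.eval a) := by
    -- The assignment is pushed into `M`, where `q` holds; `propHom M` is injective because `⊥ ≠ ⊤`,
    -- so the conclusion pulls back to `Prop`.
    let g := (propHom M).comp f
    have hg : g (q.conclusion.lhs.eval a) = g (q.conclusion.rhs.eval a) := by
      rw [← BTerm.eval_map, ← BTerm.eval_map]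
      refine hq _ fun e he => ?_
      rw [Equation.HoldsAt, BTerm.eval_map, BTerm.eval_map, ha e he]
    have hinj : Function.Injective (propHom M) := by
      intro p r hpr
      by_cases hp : p <;> by_cases hr : r <;> simp_all [propHom, eq_comm]
    exact hinj hg
  refine le_antisymm ?_ ?_ <;> by_contra h <;>
    obtain ⟨f, hf, hf'⟩ := exists_boundedLatticeHom_prop h
  · exact hf' (key f ▸ hf)
  · exact hf' ((key f).symm ▸ hf)

theorem isSC_of_distributiveLaw {V : Set BddLat.{u}}
    (h : ∀ L ∈ V, distributiveLaw.TrueIn L) : IsSC V := by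
  intro q hq L hL
  by_cases hbt : (⊥ : L) = ⊤
  · have := subsingleton_of_bot_eq_top hbt
    exact fun _ _ => Subsingleton.elim _ _
  -- One nontrivial member already separates the constant terms in `F`.
  · have hF : (⊥ : FreeAlgebra V) ≠ ⊤ := fun he => hbt (Quotient.exact he L hL fun _ => ⊥)
    let _ : DistribLattice L :=
      .ofInfSupLe fun x y z => (distributiveLaw_trueIn_iff.1 (h L hL) x y z).le
    exact hq.of_distribLattice hF (L := L)

end BoundedLatticeVariety

theorem proposition7p6 (V : Set BddLat.{u}) (hV : BoundedLatticeVariety.IsVariety V) :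
    List.TFAE
      [ BoundedLatticeVariety.IsSC V,
        BoundedLatticeVariety.IsASC V,
        ∀ L ∈ V, BoundedLatticeVariety.distributiveLaw.TrueIn L ] := by
  tfae_have 1 → 2 := fun h q hq => h q hq.1
  tfae_have 2 → 3 := fun h L hL =>
    BoundedLatticeVariety.distributiveLaw_trueIn_iff.2 (h.uniqueRelCompl hV hL).inf_sup_left
  tfae_have 3 → 1 := BoundedLatticeVariety.isSC_of_distributiveLaw
  tfae_finish
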